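/- Let $k,d\ge 1$ be integers and let $\Gamma=\langle s_1,\dots,s_d : s_1^k=\cdots=s_d^k=1\rangle$ be the free product of $d$ copies of $\mathbb Z/k\mathbb Z$. For a homomorphism $\sigma:\Gamma\to\mathrm{Sym}(n)$ let $G_\sigma$ be the hyper-graph on $[n]$ whose edges are the sets $\{\sigma(s_i^j)v : 0\le j\le k-1\}$ for $1\le i\le d$, $v\in[n]$; call $\sigma$ uniform if every edge of $G_\sigma$ has cardinality $k$. A coloring $\chi:[n]\to\{0,1\}$ is equitable if $|\chi^{-1}(0)|=|\chi^{-1}(1)|$, and proper on $G_\sigma$ if no edge of $G_\sigma$ is monochromatic. For an equitable $\chi$ let $\mathrm{Hom}_\chi(\Gamma,\mathrm{Sym}(n))$ be the set of uniform homomorphisms $\sigma$ such that $\chi$ is proper on $G_\sigma$, let $\mathbb P^\chi_n$ be the uniform probability measure on this set (the planted model) and $\mathbb E^\chi_n$ its expectation. (For $k=1$ this set is empty and the assertion below is void.) Equip it with the normalized Hamming metric $$d_{\mathrm{Hom}}(\sigma,\tau)=\sum_{i=1}^d \frac1n\,\#\{v\in[n] : \sigma(s_i)(v)\ne\tau(s_i)(v)\}.$$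 Theorem. There are constants $c,\lambda>0$, depending only on $k$ and $d$, such that for every $\delta>0$ there exists $N_\delta$ such that for all $n>N_\delta$ with $n$ even and divisible by $k$, for every equitable $\chi:[n]\to\{0,1\}$ and every function $f:\mathrm{Hom}_\chi(\Gamma,\mathrm{Sym}(n))\to\mathbb R$ that is $1$-Lipschitz for $d_{\mathrm{Hom}}$, $$\mathbb P^\chi_n\bigl(|f-\mathbb E^\chi_n[f]|>\delta\bigr)\le c\,\exp(-\lambda\delta^2 n).$$ -/

import Mathlib

open MeasureTheory ProbabilityTheory

namespace PlantedConcentration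

/-- The group `⟨s_1, …, s_d : s_1 ^ k = ⋯ = s_d ^ k = 1⟩`,
the free product of `d` copies of `ℤ / kℤ`. -/
abbrev Gam (k d : ℕ) : Type :=
  PresentedGroup (Set.range fun i : Fin d => (FreeGroup.of i) ^ k)

/-- The generator `s_i`. -/
def gen (k d : ℕ) (i : Fin d) : Gam k d :=
  PresentedGroup.of i

/-- The set of homomorphisms from the group to the symmetric group of an `n`-point set. -/
abbrev HomSym (k d n : ℕ) : Type :=
  Gam k d →* Equiv.Perm (Fin n)

/-- The edges of the hyper-graph `G_σ` on the vertex set `[n]`: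
the sets `{σ(s_i ^ j) v : 0 ≤ j ≤ k - 1}`. -/
def edges {k d n : ℕ} (σ : HomSym k d n) : Set (Finset (Fin n)) :=
  {e | ∃ (i : Fin d) (v : Fin n), e = (Finset.range k).image fun j => σ (gen k d i ^ j) v}

/-- A homomorphism is uniform if `G_σ` is a `k`-uniform hyper-graph. -/
def IsUniformHom {k d n : ℕ} (σ : HomSym k d n) : Prop :=
  ∀ e ∈ edges σ, e.card = k

/-- A 2-coloring is proper on `G_σ` if no edge is monochromatic. -/
def IsProper {k d n : ℕ} (σ : HomSym k d n) (χ : Fin n → Fin 2) : Prop :=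
  ∀ e ∈ edges σ, ∃ v ∈ e, ∃ w ∈ e, χ v ≠ χ w

/-- A 2-coloring is equitable if its two color classes have the same size. -/
def IsEquitable {n : ℕ} (χ : Fin n → Fin 2) : Prop :=
  (Finset.univ.filter fun v => χ v = 0).card = (Finset.univ.filter fun v => χ v = 1).card

/-- The uniform homomorphisms `σ` such that `χ` is proper as a coloring of `G_σ`. -/
abbrev HomChi (k d : ℕ) {n : ℕ} (χ : Fin n → Fin 2) : Type :=
  {σ : HomSym k d n // IsUniformHom σ ∧ IsProper σ χ}

/-- The normalized Hamming metric on the symmetric group. -/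
noncomputable def dSym {n : ℕ} (g h : Equiv.Perm (Fin n)) : ℝ :=
  ((Finset.univ.filter fun v => g v ≠ h v).card : ℝ) / n

/-- The normalized Hamming metric on homomorphisms. -/
noncomputable def dHom {k d n : ℕ} (σ τ : HomSym k d n) : ℝ :=
  ∑ i : Fin d, dSym (σ (gen k d i)) (τ (gen k d i))

/-- There are finitely many homomorphisms, as each is determined by the images of the
generators. -/
instance instFiniteHomSym (k d n : ℕ) : Finite (HomSym k d n) :=
  Finite.of_injective (fun (σ : HomSym k d n) (i : Fin d) => σ (gen k d i))
    (fun _ _ h => PresentedGroup.ext fun i => congrFun h i)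

/-- Every subset of the finite set of homomorphisms is an event. -/
instance instMeasurableSpaceHomChi (k d : ℕ) {n : ℕ} (χ : Fin n → Fin 2) :
    MeasurableSpace (HomChi k d χ) := ⊤

/-- The planted model: the uniform probability measure on `HomChi k d χ`. -/
noncomputable def planted (k d : ℕ) {n : ℕ} (χ : Fin n → Fin 2) : Measure (HomChi k d χ) :=
  uniformOn Set.univ

end PlantedConcentration

namespace PlantedConcentration

open Finset Equiv
open scoped BigOperators

/-! The method is an exponential moment bound, `ExpConc`, carried through elementary constructions.
It passes to a product whose fibres can be coupled at the cost of changing the base coordinate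
(`ExpConc.prod`, one martingale step), to images under maps with equinumerous fibres
(`ExpConc.map`), and to subsets of proportion at least `1 / p`, at the price of a factor `p ^ 2`
(`ExpConc.restrict`).

By the universal property, a planted homomorphism is `d` independent permutations made of
`k`-cycles, none monochromatic. Each is a conjugate of a fixed block shift by an arrangement of
`[n]` into blocks, and every such permutation comes from equally many arrangements. An arrangement
amounts to its color pattern, a word of non-constant blocks, followed by a permutation preserving
`χ`. The permutations concentrate because symmetric groups do (`expConc_perm`). The words are a
product space conditioned on color balance, an event of probability at least inverse polynomial in
`n` by Cauchy–Schwarz and color exchange (`card_pow_le_balancedWords`).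

Conditioning therefore costs only a polynomial prefactor, which half of the Gaussian exponent
absorbs once `n` is large in terms of `δ`; this is the origin of the threshold. -/

/-! ### Calculus of exponential moment bounds. -/

/-- Every function on `X` which is `L`-Lipschitz for `D` has centred exponential moment at most
`K * exp (V * L ^ 2)` under the uniform distribution. -/
def ExpConc (X : Type*) [Fintype X] (D : X → X → ℝ) (K V : ℝ) : Prop :=
  ∀ L : ℝ, 0 ≤ L → ∀ f : X → ℝ, (∀ x y, |f x - f y| ≤ L * D x y) →
    𝔼 x, Real.exp (f x - 𝔼 y, f y) ≤ K * Real.exp (V * L ^ 2)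

/-- Jensen's inequality, from `1 + t ≤ exp t` and the vanishing mean of the exponent. -/
lemma one_le_expect_exp {X : Type*} [Fintype X] [Nonempty X] (f : X → ℝ) :
    1 ≤ 𝔼 x, Real.exp (f x - 𝔼 y, f y) := by
  have h : 𝔼 x, (f x - 𝔼 y, f y + 1) ≤ 𝔼 x, Real.exp (f x - 𝔼 y, f y) :=
    expect_le_expect fun x _ => Real.add_one_le_exp _
  refine le_trans (le_of_eq ?_) h
  rw [expect_add_distrib, expect_sub_distrib, Fintype.expect_const, Fintype.expect_const]
  ring

lemma exp_expect_le {X : Type*} [Fintype X] [Nonempty X] (f : X → ℝ) :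
    Real.exp (𝔼 y, f y) ≤ 𝔼 x, Real.exp (f x) := by
  have h := one_le_expect_exp f
  calc Real.exp (𝔼 y, f y) = Real.exp (𝔼 y, f y) * 1 := by ring
    _ ≤ Real.exp (𝔼 y, f y) * 𝔼 x, Real.exp (f x - 𝔼 y, f y) := by gcongr
    _ = 𝔼 x, Real.exp (f x) := by
      rw [mul_expect]
      refine expect_congr rfl fun x _ => ?_
      rw [← Real.exp_add]
      congr 1
      ring

/-- Distances bounded by `c`. -/
lemma ExpConc.of_bounded {X : Type*} [Fintype X] {D : X → X → ℝ} {c : ℝ}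
    (hD : ∀ x y, D x y ≤ c) : ExpConc X D 1 (c ^ 2 / 2) := by
  intro L hL f hf
  rcases isEmpty_or_nonempty X with hX | hX
  · simp only [univ_eq_empty, expect_empty]
    positivity
  set a := 𝔼 y, f y with ha
  have h1 : 1 ≤ 𝔼 y, Real.exp (a - f y) := by
    have h := one_le_expect_exp (fun y => - f y)
    rw [expect_neg_distrib] at h
    refine h.trans_eq (expect_congr rfl fun x _ => ?_)
    congr 1
    ring
  have h0 : 0 ≤ 𝔼 x, Real.exp (f x - a) := expect_nonneg fun x _ => (Real.exp_pos _).le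
  -- Symmetrization: by `h1`, multiplying by the mean over an independent copy only increases the
  -- left side.
  have h2 : 𝔼 x, Real.exp (f x - a) ≤ 𝔼 x, 𝔼 y, Real.exp (f x - f y) := by
    calc 𝔼 x, Real.exp (f x - a) ≤ (𝔼 x, Real.exp (f x - a)) * 𝔼 y, Real.exp (a - f y) :=
          le_mul_of_one_le_right h0 h1
      _ = _ := by
        rw [expect_mul_expect]
        refine expect_congr rfl fun x _ => expect_congr rfl fun y _ => ?_
        rw [← Real.exp_add]
        congr 1
        ring
  -- Exchanging the two copies changes the sign of the difference, so `exp` may be averaged to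
  -- `cosh`, which is at most `exp (t ^ 2 / 2)`.
  have h3 : 𝔼 x, 𝔼 y, Real.exp (f x - f y) = 𝔼 x, 𝔼 y, Real.cosh (f x - f y) := by
    have h4 : 𝔼 x, 𝔼 y, Real.exp (f x - f y) = 𝔼 x, 𝔼 y, Real.exp (-(f x - f y)) := by
      rw [expect_comm]
      refine expect_congr rfl fun x _ => expect_congr rfl fun y _ => ?_
      rw [neg_sub]
    have h5 : 𝔼 x, 𝔼 y, Real.cosh (f x - f y) =
        ((𝔼 x, 𝔼 y, Real.exp (f x - f y)) + 𝔼 x, 𝔼 y, Real.exp (-(f x - f y))) / 2 := by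
      simp_rw [Real.cosh_eq, ← expect_div, expect_add_distrib]
    rw [h5, ← h4]
    ring
  rw [h3] at h2
  refine h2.trans ?_
  rw [one_mul]
  refine expect_le univ_nonempty fun x _ => expect_le univ_nonempty fun y _ => ?_
  refine (Real.cosh_le_exp_half_sq _).trans (Real.exp_le_exp.2 ?_)
  have h6 : |f x - f y| ≤ L * c := (hf x y).trans (by gcongr; exact hD x y)
  have h7 := sq_le_sq' (by linarith [neg_abs_le (f x - f y), abs_nonneg (f x - f y)]) h6
  rw [sq_abs] at h7
  nlinarith

lemma ExpConc.mono {X : Type*} [Fintype X] {D D' : X → X → ℝ} {K K' V V' : ℝ}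
    (h : ExpConc X D K V) (hD : ∀ x y, D' x y ≤ D x y) (hK : K ≤ K') (hK' : 0 ≤ K')
    (hV : V ≤ V') : ExpConc X D' K' V' := by
  intro L hL f hf
  refine (h L hL f fun x y => (hf x y).trans ?_).trans ?_
  · gcongr
    exact hD x y
  · gcongr

lemma ExpConc.scale {X : Type*} [Fintype X] {D : X → X → ℝ} {K V c : ℝ}
    (h : ExpConc X D K V) (hc : 0 ≤ c) : ExpConc X (fun x y => c * D x y) K (c ^ 2 * V) := by
  intro L hL f hf
  refine (h (L * c) (by positivity) f fun x y => ?_).trans_eq ?_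
  · rw [mul_assoc]
    exact hf x y
  · congr 2
    ring

/-- A product whose first coordinate may be changed at small cost after rearranging the second. -/
lemma ExpConc.prod {I Y : Type*} [Fintype I] [Fintype Y] {DI : I → I → ℝ} {DY : Y → Y → ℝ}
    {D : I × Y → I × Y → ℝ} {KI VI KY VY : ℝ} (hI : ExpConc I DI KI VI) (hY : ExpConc Y DY KY VY)
    (hK : 0 ≤ KY) (h1 : ∀ i y y', D (i, y) (i, y') ≤ DY y y')
    (h2 : ∀ i j, ∃ e : Y ≃ Y, ∀ y, D (i, y) (j, e y) ≤ DI i j) :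
    ExpConc (I × Y) D (KI * KY) (VI + VY) := by
  intro L hL f hf
  rcases isEmpty_or_nonempty Y with hE | hE
  · rcases isEmpty_or_nonempty I with hE' | hE'
    · have := hI L hL (fun _ => 0) (fun x => hE'.elim x)
      simp only [univ_eq_empty, expect_empty] at this ⊢
      have hK' : 0 ≤ KI := nonneg_of_mul_nonneg_left this (Real.exp_pos _)
      positivity
    · have := hY L hL (fun _ => 0) (fun x => hE.elim x)
      have h' := hI 0 le_rfl (fun _ => 0) (by simp)
      simp at h'
      simp only [univ_eq_empty, expect_empty]
      have hK' : 0 ≤ KI := by linarith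
      positivity
  set F : I → ℝ := fun i => 𝔼 y, f (i, y) with hF
  have hFf : 𝔼 x, f x = 𝔼 i, F i := by
    rw [← univ_product_univ, expect_product]
  -- The rearrangement `e` leaves the fibre mean unchanged, so it couples the fibres over `i` and
  -- `j` pointwise at cost `DI i j`.
  have hlip : ∀ i j, |F i - F j| ≤ L * DI i j := by
    have key : ∀ i j, F i - F j ≤ L * DI i j := by
      intro i j
      obtain ⟨e, he⟩ := h2 i j
      have h3 : F j = 𝔼 y, f (j, e y) :=
        (Fintype.expect_equiv e _ _ fun y => rfl).symm
      rw [h3, hF, ← expect_sub_distrib]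
      refine expect_le univ_nonempty fun y _ => ?_
      refine (le_abs_self _).trans ((hf _ _).trans ?_)
      gcongr
      exact he y
    have key' : ∀ i j, F j - F i ≤ L * DI i j := by
      intro i j
      obtain ⟨e, he⟩ := h2 i j
      have h3 : F j = 𝔼 y, f (j, e y) :=
        (Fintype.expect_equiv e _ _ fun y => rfl).symm
      rw [h3, hF, ← expect_sub_distrib]
      refine expect_le univ_nonempty fun y _ => ?_
      refine (le_abs_self _).trans ?_
      rw [abs_sub_comm]
      refine (hf _ _).trans ?_
      gcongr
      exact he y
    intro i j
    exact abs_le.2 ⟨by linarith [key' i j], key i j⟩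
  rw [hFf, ← univ_product_univ, expect_product]
  have hKI := hI L hL F hlip
  -- Martingale splitting: fluctuation within the fibre over `i`, plus fluctuation of the fibre
  -- mean.
  have h5 : ∀ i, 𝔼 y, Real.exp (f (i, y) - 𝔼 j, F j) ≤
      Real.exp (F i - 𝔼 j, F j) * (KY * Real.exp (VY * L ^ 2)) := by
    intro i
    have := hY L hL (fun y => f (i, y)) fun y y' => (hf _ _).trans (by gcongr; exact h1 i y y')
    refine le_trans (le_of_eq ?_) (mul_le_mul_of_nonneg_left this (Real.exp_pos _).le)
    rw [mul_expect]
    refine expect_congr rfl fun y _ => ?_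
    rw [← Real.exp_add]
    congr 1
    simp only [hF]
    ring
  refine (expect_le_expect fun i _ => h5 i).trans ?_
  rw [← expect_mul]
  refine (mul_le_mul_of_nonneg_right hKI (by positivity)).trans_eq ?_
  rw [add_mul, Real.exp_add]
  ring

lemma expect_comp_of_card_fiber {X Y : Type*} [Fintype X] [Fintype Y] [DecidableEq X]
    (φ : Y → X) {N : ℕ} (hN : N ≠ 0)
    (hφ : ∀ x, (univ.filter fun y => φ y = x).card = N) (f : X → ℝ) :
    𝔼 y, f (φ y) = 𝔼 x, f x := by
  have h1 : ∑ y, f (φ y) = N * ∑ x, f x := by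
    rw [← sum_fiberwise_of_maps_to (g := φ) (t := univ) (fun _ _ => mem_univ _), mul_sum]
    refine sum_congr rfl fun x _ => ?_
    rw [sum_congr rfl (g := fun _ => f x) fun y hy => by rw [(mem_filter.1 hy).2], sum_const, hφ,
      nsmul_eq_mul]
  have h2 : Fintype.card Y = N * Fintype.card X := by
    rw [← card_univ, card_eq_sum_card_fiberwise (f := φ) (t := univ) (fun _ _ => mem_univ _)]
    simp [hφ, mul_comm]
  rw [Fintype.expect_eq_sum_div_card, Fintype.expect_eq_sum_div_card, h1, h2]
  push_cast
  rw [mul_div_mul_left]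
  exact_mod_cast hN

/-- Push-forward along a map all of whose fibres have the same size. -/
lemma ExpConc.map {X Y : Type*} [Fintype X] [Fintype Y] [DecidableEq X] {DX : X → X → ℝ}
    {DY : Y → Y → ℝ} {K V : ℝ} (h : ExpConc Y DY K V) (φ : Y → X) {N : ℕ} (hN : N ≠ 0)
    (hφ : ∀ x, (univ.filter fun y => φ y = x).card = N)
    (hD : ∀ y y', DX (φ y) (φ y') ≤ DY y y') : ExpConc X DX K V := by
  intro L hL f hf
  have := h L hL (fun y => f (φ y)) fun y y' => (hf _ _).trans (by gcongr; exact hD y y')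
  rwa [expect_comp_of_card_fiber φ hN hφ f,
    expect_comp_of_card_fiber φ hN hφ (fun x => Real.exp (f x - 𝔼 x, f x))] at this

lemma ExpConc.map_bijective {X Y : Type*} [Fintype X] [Fintype Y] {DX : X → X → ℝ}
    {DY : Y → Y → ℝ} {K V : ℝ} (h : ExpConc Y DY K V) (φ : Y → X) (hφ : Function.Bijective φ)
    (hD : ∀ y y', DX (φ y) (φ y') ≤ DY y y') : ExpConc X DX K V := by
  classical
  refine h.map φ one_ne_zero (fun x => ?_) hD
  obtain ⟨y, rfl⟩ := hφ.2 x
  rw [card_eq_one]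
  exact ⟨y, by ext z; simp [hφ.1.eq_iff]⟩

/-- Conditioning on a subset of proportion at least `1 / p`. -/
lemma ExpConc.restrict {X Y : Type*} [Fintype X] [Fintype Y] {D : X → X → ℝ} {K V p : ℝ}
    (h : ExpConc X D K V) (ι : Y → X) (hι : Function.Injective ι)
    (hD0 : ∀ x, D x x = 0) (hDc : ∀ x y, D x y = D y x) (hDt : ∀ x y z, D x z ≤ D x y + D y z)
    (hp : (Fintype.card X : ℝ) ≤ p * Fintype.card Y) :
    ExpConc Y (fun y y' => D (ι y) (ι y')) (p ^ 2 * K ^ 2) (2 * V) := by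
  intro L hL f hf
  rcases isEmpty_or_nonempty Y with hE | hE
  · simp only [univ_eq_empty, expect_empty]
    positivity
  -- McShane extension of `f` from the subset to the whole space, with the same Lipschitz constant.
  set g : X → ℝ := fun x => univ.inf' univ_nonempty fun y => f y + L * D (ι y) x with hg
  have hgι : ∀ y, g (ι y) = f y := by
    intro y
    apply le_antisymm
    · refine (inf'_le _ (mem_univ y)).trans_eq ?_
      rw [hD0]
      ring
    · refine le_inf' _ _ fun z _ => ?_
      have h1 : |f y - f z| ≤ L * D (ι y) (ι z) := hf y z
      rw [hDc (ι y) (ι z)] at h1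
      linarith [le_abs_self (f y - f z)]
  have hg1 : ∀ x x', g x - g x' ≤ L * D x x' := by
    intro x x'
    obtain ⟨y, -, hy⟩ := exists_mem_eq_inf' univ_nonempty fun y => f y + L * D (ι y) x'
    have h1 : g x ≤ f y + L * D (ι y) x := inf'_le _ (mem_univ y)
    have h2 : g x' = f y + L * D (ι y) x' := hy
    have h3 := mul_le_mul_of_nonneg_left (hDt (ι y) x' x) hL
    rw [hDc x x']
    linarith
  have hglip : ∀ x x', |g x - g x'| ≤ L * D x x' := fun x x' =>
    abs_le.2 ⟨by linarith [hDc x x' ▸ hg1 x' x], hg1 x x'⟩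
  -- The bound on `X` controls deviations from the mean of `g` over `X`, not from the mean of `f`
  -- over `Y`. Replacing one center by the other (`down`) takes a second use of the bound, hence the
  -- squares and the doubled variance.
  set a := 𝔼 x, g x with ha
  have hX : (0 : ℝ) < Fintype.card X := by
    have : Nonempty X := ⟨ι (Classical.arbitrary Y)⟩
    exact_mod_cast Fintype.card_pos
  have hY : (0 : ℝ) < Fintype.card Y := by exact_mod_cast Fintype.card_pos
  have hp0 : 0 < p := by
    by_contra hcon
    nlinarith
  have sub : ∀ F : X → ℝ, (∀ x, 0 ≤ F x) → 𝔼 y, F (ι y) ≤ p * 𝔼 x, F x := by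
    intro F hF
    have h1 : ∑ y, F (ι y) ≤ ∑ x, F x := by
      classical
      rw [← sum_image (f := F) (g := ι) (s := univ) (fun _ _ _ _ h => hι h)]
      exact sum_le_sum_of_subset_of_nonneg (subset_univ _) fun x _ _ => hF x
    have h0 : 0 ≤ ∑ x, F x := sum_nonneg fun x _ => hF x
    rw [Fintype.expect_eq_sum_div_card, Fintype.expect_eq_sum_div_card, ← mul_div_assoc,
      div_le_div_iff₀ hY hX]
    nlinarith
  have up : 𝔼 y, Real.exp (f y - a) ≤ p * (K * Real.exp (V * L ^ 2)) := by
    have h1 := sub (fun x => Real.exp (g x - a)) fun x => (Real.exp_pos _).le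
    simp only [hgι] at h1
    refine h1.trans ?_
    gcongr
    exact h L hL g hglip
  have down : Real.exp (a - 𝔼 y, f y) ≤ p * (K * Real.exp (V * L ^ 2)) := by
    have h1 := sub (fun x => Real.exp (a - g x)) fun x => (Real.exp_pos _).le
    simp only [hgι] at h1
    have h2 := exp_expect_le fun y => a - f y
    rw [expect_sub_distrib, Fintype.expect_const] at h2
    refine h2.trans (h1.trans ?_)
    gcongr
    have h3 := h L hL (fun x => - g x) fun x y => by
      rw [neg_sub_neg, abs_sub_comm]
      exact hglip x y
    rw [expect_neg_distrib] at h3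
    refine le_trans (le_of_eq (expect_congr rfl fun x _ => ?_)) h3
    congr 1
    ring
  have h0 : 0 ≤ 𝔼 y, Real.exp (f y - a) := expect_nonneg fun x _ => (Real.exp_pos _).le
  calc 𝔼 y, Real.exp (f y - 𝔼 z, f z)
      = (𝔼 y, Real.exp (f y - a)) * Real.exp (a - 𝔼 y, f y) := by
        rw [expect_mul]
        refine expect_congr rfl fun x _ => ?_
        rw [← Real.exp_add]
        congr 1
        ring
    _ ≤ (p * (K * Real.exp (V * L ^ 2))) * (p * (K * Real.exp (V * L ^ 2))) :=
        mul_le_mul up down (Real.exp_pos _).le (h0.trans up)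
    _ = p ^ 2 * K ^ 2 * Real.exp (2 * V * L ^ 2) := by
        rw [show 2 * V * L ^ 2 = V * L ^ 2 + V * L ^ 2 by ring, Real.exp_add]
        ring

/-- Powers, with the sum distance. -/
lemma ExpConc.pi {X : Type*} [Fintype X] {D : X → X → ℝ} {K V : ℝ} (h : ExpConc X D K V)
    (hK : 0 ≤ K) (hD0 : ∀ x, D x x = 0) (d : ℕ) :
    ExpConc (Fin d → X) (fun x y => ∑ i, D (x i) (y i)) (K ^ d) (d * V) := by
  induction d with
  | zero =>
    exact (ExpConc.of_bounded (c := 0) (fun x y => by simp)).mono (fun _ _ => le_rfl) (by simp)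
      (by simp) (by simp)
  | succ d ih =>
    have h1 : ExpConc (X × (Fin d → X))
        (fun x y => D x.1 y.1 + ∑ i, D (x.2 i) (y.2 i)) (K * K ^ d) (V + d * V) := by
      refine h.prod ih (by positivity) (fun i y y' => ?_) fun i j => ⟨Equiv.refl _, fun y => ?_⟩
      · simp [hD0]
      · simp [hD0]
    have h2 := h1.map_bijective (DX := fun x y : Fin (d + 1) → X => ∑ i, D (x i) (y i))
      (Fin.consEquiv fun _ => X) (Equiv.bijective _) (fun y y' => by
        simp [Fin.sum_univ_succ, Fin.consEquiv])
    refine h2.mono (fun _ _ => le_rfl) (by rw [pow_succ']) (by positivity) (le_of_eq ?_)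
    push_cast
    ring

/-- Gaussian tail bound. -/
lemma ExpConc.tail {X : Type*} [Fintype X] [Nonempty X] {D : X → X → ℝ} {K V δ : ℝ}
    (h : ExpConc X D K V) (hV : 0 < V) (hδ : 0 < δ) (f : X → ℝ)
    (hf : ∀ x y, |f x - f y| ≤ D x y) :
    ((univ.filter fun x => δ < |f x - 𝔼 y, f y|).card : ℝ) / Fintype.card X ≤
      2 * K * Real.exp (-(δ ^ 2 / (4 * V))) := by
  -- The Chernoff parameter minimizing `V * s ^ 2 - s * δ`; the minimum is `-δ ^ 2 / (4 * V)`.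
  set s := δ / (2 * V) with hs
  have hs0 : 0 < s := by positivity
  have one : ∀ g : X → ℝ, (∀ x y, |g x - g y| ≤ D x y) →
      𝔼 x, Real.exp (s * (g x - 𝔼 y, g y)) ≤ K * Real.exp (V * s ^ 2) := by
    intro g hg
    have h1 := h s hs0.le (fun x => s * g x) fun x y => by
      rw [← mul_sub, abs_mul, abs_of_pos hs0]
      gcongr
      exact hg x y
    rw [← mul_expect] at h1
    simpa only [mul_sub] using h1
  have h1 := one f hf
  have h2 := one (fun x => - f x) fun x y => by
    rw [neg_sub_neg, abs_sub_comm]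
    exact hf x y
  rw [expect_neg_distrib] at h2
  set a := 𝔼 y, f y with ha
  have h3 : 𝔼 x, (if δ < |f x - a| then Real.exp (s * δ) else 0) ≤
      𝔼 x, (Real.exp (s * (f x - a)) + Real.exp (s * (- f x - -a))) := by
    refine expect_le_expect fun x _ => ?_
    have e1 := Real.exp_pos (s * (f x - a))
    have e2 := Real.exp_pos (s * (- f x - -a))
    split_ifs with hx
    · rcases lt_abs.1 hx with hx | hx
      · have : Real.exp (s * δ) ≤ Real.exp (s * (f x - a)) := by gcongr
        linarith
      · have : Real.exp (s * δ) ≤ Real.exp (s * (- f x - -a)) := by gcongr; linarith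
        linarith
    · positivity
  rw [expect_add_distrib] at h3
  have h4 : 𝔼 x, (if δ < |f x - a| then Real.exp (s * δ) else 0) =
      ((univ.filter fun x => δ < |f x - a|).card : ℝ) / Fintype.card X * Real.exp (s * δ) := by
    rw [Fintype.expect_eq_sum_div_card, ← sum_filter, sum_const, nsmul_eq_mul]
    ring
  rw [h4] at h3
  have h5 : δ ^ 2 / (4 * V) = s * δ - V * s ^ 2 := by
    rw [hs]
    field_simp
    ring
  have h6 : ((univ.filter fun x => δ < |f x - a|).card : ℝ) / Fintype.card X * Real.exp (s * δ) ≤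
      2 * K * Real.exp (V * s ^ 2) := by linarith
  rw [h5, neg_sub, Real.exp_sub, ← mul_div_assoc, le_div_iff₀ (Real.exp_pos _)]
  exact h6

/-! ### Symmetric groups and color-preserving permutations. -/

/-- Concentration on the symmetric group for the Hamming distance. -/
lemma expConc_perm (α : Type) [Fintype α] [DecidableEq α] :
    ExpConc (Perm α) (fun g h => (hammingDist ⇑g ⇑h : ℝ)) 1 (5 * Fintype.card α) := by
  suffices h : ∀ [DecidableEq α], ExpConc (Perm α) (fun g h => (hammingDist ⇑g ⇑h : ℝ)) 1
      (5 * Fintype.card α) from h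
  refine Fintype.induction_empty_option (P := fun α _ => ∀ [DecidableEq α],
    ExpConc (Perm α) (fun g h => (hammingDist ⇑g ⇑h : ℝ)) 1 (5 * Fintype.card α)) ?_ ?_ ?_ α
  · intro α β _ e ih _
    classical
    let _ := Fintype.ofEquiv β e.symm
    rw [← Fintype.card_congr e]
    refine ih.map_bijective e.permCongr (Equiv.bijective _) fun g h => ?_
    norm_cast
    refine le_of_eq (card_equiv e.symm fun x => ?_)
    simp
  · intro _
    exact (ExpConc.of_bounded (c := 0) (fun x y => by simp [hammingDist])).mono
      (fun _ _ => le_rfl) (by simp) (by simp) (by simp)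
  · intro α _ ih
    classical
    suffices h : ExpConc (Perm (Option α)) (fun g h => (hammingDist ⇑g ⇑h : ℝ)) 1
        (5 * Fintype.card (Option α)) by
      intro _
      convert h
    -- A permutation of `Option α` is `swap none i * g.optionCongr`. Replacing `i` by `j` affects
    -- only the preimages of `none`, `i` and `j`, so each new point adds `3 ^ 2 / 2 ≤ 5` to the
    -- variance.
    have h1 : ExpConc (Option α × Perm α)
        (fun x y => (hammingDist ⇑(Perm.decomposeOption.symm x)
          ⇑(Perm.decomposeOption.symm y) : ℝ)) (1 * 1) (3 ^ 2 / 2 + 5 * Fintype.card α) := by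
      refine ExpConc.prod (DI := fun _ _ => 3) (ExpConc.of_bounded fun _ _ => le_rfl) ih zero_le_one
        (fun i g h => ?_) fun i j => ⟨Equiv.refl _, fun g => ?_⟩
      · norm_cast
        refine (card_le_card (t := (univ.filter fun x => g x ≠ h x).map Function.Embedding.some)
          fun x hx => ?_).trans_eq (card_map _)
        rcases x with _ | x
        · simp at hx
        · simpa using hx
      · norm_cast
        calc hammingDist ⇑(Perm.decomposeOption.symm (i, g))
              ⇑(Perm.decomposeOption.symm (j, (Equiv.refl _) g))
            ≤ (({none, i, j} : Finset (Option α)).map g.optionCongr.symm.toEmbedding).card := by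
              refine card_le_card fun x hx => ?_
              rw [mem_filter] at hx
              by_contra hcon
              refine hx.2 ?_
              simp only [mem_map_equiv, symm_symm, mem_insert, mem_singleton, not_or] at hcon
              simp only [Perm.decomposeOption_symm_apply, Perm.mul_apply, Equiv.refl_apply]
              rw [swap_apply_of_ne_of_ne hcon.1 hcon.2.1, swap_apply_of_ne_of_ne hcon.1 hcon.2.2]
          _ ≤ 3 := by
              rw [card_map]
              exact card_le_three
    refine (h1.map_bijective (DX := fun g h : Perm (Option α) => (hammingDist ⇑g ⇑h : ℝ))
      Perm.decomposeOption.symm (Equiv.bijective _) fun _ _ => le_rfl).mono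
      (fun _ _ => le_rfl) (mul_one _).le zero_le_one ?_
    rw [Fintype.card_option]
    push_cast
    linarith

/-- Concentration on the group of permutations preserving a 2-coloring. -/
lemma expConc_preserving {β : Type} [Fintype β] [DecidableEq β] (χ : β → Fin 2)
    [Fintype {h : Perm β // ∀ v, χ (h v) = χ v}] :
    ExpConc {h : Perm β // ∀ v, χ (h v) = χ v}
      (fun g h => (hammingDist ⇑g.1 ⇑h.1 : ℝ)) 1 (5 * Fintype.card β) := by
  -- Such a permutation is a pair of permutations of the two color classes; Hamming distances and
  -- class sizes both add.
  have h1 : ExpConc (Perm {v // χ v = 0} × Perm {v // ¬ χ v = 0})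
      (fun x y => (hammingDist ⇑x.1 ⇑y.1 : ℝ) + hammingDist ⇑x.2 ⇑y.2) (1 * 1)
      (5 * Fintype.card {v // χ v = 0} + 5 * Fintype.card {v // ¬ χ v = 0}) := by
    refine ExpConc.prod (expConc_perm _) (expConc_perm _) zero_le_one (fun i g h => ?_)
      fun i j => ⟨Equiv.refl _, fun g => ?_⟩
    · simp
    · simp
  have hfin : ∀ a : Fin 2, ¬ a = 0 → a = 1 := by decide
  have hl : ∀ (a : Perm {v // χ v = 0}) (b : Perm {v // ¬ χ v = 0}) (v : β) (hv : χ v = 0),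
      Perm.subtypeCongr a b v = a ⟨v, hv⟩ := fun a b v hv => Perm.subtypeCongr.left_apply a b hv
  have hr : ∀ (a : Perm {v // χ v = 0}) (b : Perm {v // ¬ χ v = 0}) (v : β) (hv : ¬ χ v = 0),
      Perm.subtypeCongr a b v = b ⟨v, hv⟩ := fun a b v hv => Perm.subtypeCongr.right_apply a b hv
  have hmem : ∀ x : Perm {v // χ v = 0} × Perm {v // ¬ χ v = 0},
      ∀ v, χ (Perm.subtypeCongr x.1 x.2 v) = χ v := by
    intro x v
    by_cases hv : χ v = 0
    · rw [hl _ _ _ hv, hv]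
      exact (x.1 ⟨v, hv⟩).2
    · rw [hr _ _ _ hv, hfin _ hv]
      exact hfin _ (x.2 ⟨v, hv⟩).2
  refine (h1.map_bijective (DX := fun g h : {h : Perm β // ∀ v, χ (h v) = χ v} =>
      (hammingDist ⇑g.1 ⇑h.1 : ℝ))
    (fun x => ⟨Perm.subtypeCongr x.1 x.2, hmem x⟩) ⟨?_, ?_⟩ ?_).mono
    (fun _ _ => le_rfl) (mul_one _).le zero_le_one (le_of_eq ?_)
  · intro x y hxy
    exact Perm.subtypeCongrHom_injective _ (Subtype.ext_iff.1 hxy)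
  · rintro ⟨h, hh⟩
    refine ⟨(h.subtypePerm fun v => by rw [hh], h.subtypePerm fun v => by rw [hh]), ?_⟩
    ext v
    by_cases hv : χ v = 0
    · simp [hl _ _ _ hv]
    · simp [hr _ _ _ hv]
  · rintro ⟨a, b⟩ ⟨a', b'⟩
    norm_cast
    calc hammingDist ⇑(Perm.subtypeCongr a b) ⇑(Perm.subtypeCongr a' b')
        ≤ ((univ.filter fun x => a x ≠ a' x).map (Function.Embedding.subtype _) ∪
            (univ.filter fun x => b x ≠ b' x).map (Function.Embedding.subtype _)).card := by
          refine card_le_card fun v hv => ?_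
          rw [mem_filter] at hv
          rw [mem_union]
          by_cases h0 : χ v = 0
          · left
            rw [mem_map]
            refine ⟨⟨v, h0⟩, ?_, rfl⟩
            simpa [hl _ _ _ h0, Subtype.ext_iff] using hv.2
          · right
            rw [mem_map]
            refine ⟨⟨v, h0⟩, ?_, rfl⟩
            simpa [hr _ _ _ h0, Subtype.ext_iff] using hv.2
      _ ≤ _ := (card_union_le _ _).trans_eq (by rw [card_map, card_map]; rfl)
  · rw [← mul_add]
    norm_cast
    rw [Fintype.card_subtype_compl, Nat.add_sub_cancel' (Fintype.card_subtype_le _)]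

/-- Two colorings with equal color classes differ by a permutation supported where they differ. -/
lemma exists_perm_of_card_fiber {α γ : Type} [Fintype α] [DecidableEq α] [DecidableEq γ]
    (f g : α → γ)
    (h : ∀ c, (univ.filter fun x => f x = c).card = (univ.filter fun x => g x = c).card) :
    ∃ τ : Perm α, (∀ x, f (τ x) = g x) ∧ ∀ x, f x = g x → τ x = x := by
  -- The points where `f` and `g` agree contribute equally to both fibres over `c`, so the fibres
  -- still match in size on the disagreement set.
  have hQ : ∀ c, Nonempty ({x : {x // f x ≠ g x} // g x.1 = c} ≃
      {x : {x // f x ≠ g x} // f x.1 = c}) := by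
    intro c
    rw [← Fintype.card_eq, Fintype.card_subtype, Fintype.card_subtype]
    have key : ∀ u : α → γ, (univ.filter fun x : {x // f x ≠ g x} => u x.1 = c).card =
        (univ.filter fun x => f x ≠ g x ∧ u x = c).card := by
      intro u
      rw [← card_map (Function.Embedding.subtype _)]
      congr 1
      ext x
      simp [and_comm]
    rw [key, key]
    have split : ∀ u : α → γ, (univ.filter fun x => u x = c).card =
        (univ.filter fun x => f x = g x ∧ u x = c).card +
        (univ.filter fun x => f x ≠ g x ∧ u x = c).card := by
      intro u
      rw [← card_filter_add_card_filter_not (s := univ.filter fun x => u x = c)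
        (fun x => f x = g x), filter_filter, filter_filter]
      congr 2 <;> ext x <;> simp only [mem_filter, mem_univ, true_and] <;> exact and_comm
    have e : (univ.filter fun x => f x = g x ∧ f x = c) =
        univ.filter fun x => f x = g x ∧ g x = c := by
      ext x
      simp only [mem_filter, mem_univ, true_and]
      constructor
      · rintro ⟨h1, h2⟩
        exact ⟨h1, h1 ▸ h2⟩
      · rintro ⟨h1, h2⟩
        exact ⟨h1, h1.symm ▸ h2⟩
    have h1 := h c
    rw [split f, split g, e] at h1
    omega
  have e := fun c => (hQ c).some
  let τ : Perm {x // f x ≠ g x} := Equiv.ofFiberEquiv e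
  have hτ : ∀ x, f (τ x).1 = g x.1 := fun x =>
    Equiv.ofFiberEquiv_map (f := fun x : {x // f x ≠ g x} => g x.1)
      (g := fun x : {x // f x ≠ g x} => f x.1) e x
  refine ⟨Perm.ofSubtype (p := fun x => f x ≠ g x) τ, fun x => ?_, fun x hx => ?_⟩
  · by_cases hx : f x = g x
    · rw [Perm.ofSubtype_apply_of_not_mem (p := fun x => f x ≠ g x) _ (by simpa using hx), hx]
    · rw [Perm.ofSubtype_apply_of_mem (p := fun x => f x ≠ g x) _ hx]
      exact hτ ⟨x, hx⟩
  · exact Perm.ofSubtype_apply_of_not_mem (p := fun x => f x ≠ g x) _ (by simpa using hx)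

/-! ### Balanced words of non-constant blocks. -/

/-- The non-constant 2-colorings of a block of size `k`. -/
abbrev Block (k : ℕ) : Type := {a : Fin k → Fin 2 // ∃ b b', a b ≠ a b'}

/-- The number of points of color `1`. -/
def wt {k : ℕ} (a : Block k) : ℕ := ∑ b, (a.1 b : ℕ)

/-- Exchange of the two colors. -/
def Block.flip {k : ℕ} : Block k ≃ Block k where
  toFun a := ⟨fun b => (a.1 b).rev, by
    obtain ⟨b, b', h⟩ := a.2
    exact ⟨b, b', fun h' => h (Fin.rev_injective h')⟩⟩
  invFun a := ⟨fun b => (a.1 b).rev, by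
    obtain ⟨b, b', h⟩ := a.2
    exact ⟨b, b', fun h' => h (Fin.rev_injective h')⟩⟩
  left_inv a := by ext; simp
  right_inv a := by ext; simp

lemma wt_add_wt_flip {k : ℕ} (a : Block k) : wt (Block.flip a) + wt a = k := by
  rw [wt, wt, ← sum_add_distrib]
  have : ∀ b, ((Block.flip a).1 b : ℕ) + (a.1 b : ℕ) = 1 := by
    intro b
    change ((a.1 b).rev : ℕ) + (a.1 b : ℕ) = 1
    rw [Fin.val_rev]
    have := (a.1 b).2
    omega
  simp [this]

/-- Since `S` takes at most `M + 1` values, Cauchy–Schwarz bounds the number of pairs with `S p.1 =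
S p.2` from below; applying `e` to the second entry turns these into pairs of sum `M`. -/
lemma card_sq_le_of_flip {T : Type*} [Fintype T] (S : T → ℕ) (M : ℕ) (e : T ≃ T)
    (he : ∀ t, S (e t) + S t = M) :
    Fintype.card T ^ 2 ≤ (M + 1) * (univ.filter fun p : T × T => S p.1 + S p.2 = M).card := by
  have h1 : Fintype.card T = ∑ j ∈ range (M + 1), (univ.filter fun t => S t = j).card := by
    rw [← card_univ]
    exact card_eq_sum_card_fiberwise fun t _ => by simpa using (by have := he t; omega : S t ≤ M)
  have h2 : (univ.filter fun p : T × T => S p.1 = S p.2).card =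
      ∑ j ∈ range (M + 1), (univ.filter fun t => S t = j).card ^ 2 := by
    rw [card_eq_sum_card_fiberwise (f := fun p : T × T => S p.1) (t := range (M + 1))
      fun p _ => by simpa using (by have := he p.1; omega : S p.1 ≤ M)]
    refine sum_congr rfl fun j _ => ?_
    rw [sq, ← card_product]
    congr 1
    ext p
    simp only [mem_filter, mem_univ, true_and, mem_product]
    constructor
    · rintro ⟨h, h'⟩
      exact ⟨h', h ▸ h'⟩
    · rintro ⟨h, h'⟩
      exact ⟨h.trans h'.symm, h⟩
  have h3 : (univ.filter fun p : T × T => S p.1 = S p.2).card =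
      (univ.filter fun p : T × T => S p.1 + S p.2 = M).card := by
    refine card_equiv ((Equiv.refl T).prodCongr e) fun p => ?_
    have := he p.2
    simp only [mem_filter, mem_univ, true_and, Equiv.prodCongr_apply, Prod.map, Equiv.refl_apply]
    omega
  rw [← h3, h2, h1]
  have := sq_sum_le_card_mul_sum_sq (s := range (M + 1))
    (f := fun j => (univ.filter fun t => S t = j).card)
  simpa using this

/-- The words of `m` non-constant blocks of size `k` with as many points of each color. -/
abbrev balancedWords (m k : ℕ) : Finset (Fin m → Block k) :=
  univ.filter fun w => 2 * ∑ i, wt (w i) = m * k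

/-- A word is cut into two halves of length `r`, and `card_sq_le_of_flip` is applied with exchange
of colors. -/
lemma card_pow_le_balancedWords_even (r k : ℕ) :
    Fintype.card (Block k) ^ (r + r) ≤ (r * k + 1) * (balancedWords (r + r) k).card := by
  have h := card_sq_le_of_flip (T := Fin r → Block k) (fun w => ∑ i, wt (w i)) (r * k)
    (Equiv.piCongrRight fun _ => Block.flip) fun w => by
      rw [← sum_add_distrib]
      simp [wt_add_wt_flip]
  rw [Fintype.card_fun, Fintype.card_fin, ← pow_mul, mul_two] at h
  refine h.trans_eq ?_
  congr 1
  refine card_equiv (Fin.appendEquiv r r) fun p => ?_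
  simp only [mem_filter, mem_univ, true_and, Fin.appendEquiv, Equiv.coe_fn_mk,
    Fin.sum_univ_add, Fin.append_left, Fin.append_right]
  rw [add_mul]
  omega

lemma exists_wt_eq_half (q : ℕ) (hq : 0 < q) : ∃ a : Block (q + q), wt a = q := by
  refine ⟨⟨Fin.append (fun _ => 1) (fun _ => 0), Fin.castAdd q ⟨0, hq⟩, Fin.natAdd q ⟨0, hq⟩, ?_⟩,
    ?_⟩
  · rw [Fin.append_left, Fin.append_right]
    decide
  · rw [wt, Fin.sum_univ_add]
    simp only [Fin.append_left, Fin.append_right]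
    simp

/-- For odd `m` the parity condition makes `k` even, so a block with half its points of each color
can be prepended to a balanced word of even length. The factor `2 ^ k` bounds the choices for that
block. -/
lemma card_pow_le_balancedWords (m k : ℕ) (hk : 2 ≤ k) (hmk : Even (m * k)) :
    Fintype.card (Block k) ^ m ≤
      2 ^ k * (m * k + 1) * (balancedWords m k).card := by
  have hA : Fintype.card (Block k) ≤ 2 ^ k := by
    refine (Fintype.card_subtype_le _).trans_eq ?_
    simp
  rcases Nat.even_or_odd' m with ⟨r, rfl | rfl⟩
  · rw [two_mul r]
    refine (card_pow_le_balancedWords_even r k).trans ?_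
    gcongr
    have : 1 ≤ 2 ^ k := Nat.one_le_two_pow
    nlinarith [Nat.zero_le (r * k)]
  · rw [two_mul r] at hmk ⊢
    have hk2 : Even k := by
      rcases Nat.even_mul.1 hmk with h | h
      · exact absurd h (by simp [← two_mul])
      · exact h
    obtain ⟨q, rfl⟩ := hk2
    obtain ⟨a, ha⟩ := exists_wt_eq_half q (by omega)
    have h1 : (balancedWords (r + r) (q + q)).card ≤ (balancedWords (r + r + 1) (q + q)).card := by
      refine card_le_card_of_injOn (fun w => Fin.cons a w) ?_ ?_
      · intro w hw
        simp only [coe_filter, mem_univ, true_and, Set.mem_ofPred_eq] at hw ⊢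
        rw [Fin.sum_univ_succ]
        simp only [Fin.cons_zero, Fin.cons_succ]
        rw [mul_add, hw, ha]
        ring
      · intro w _ w' _ h
        exact Fin.cons_right_injective (α := fun _ => Block (q + q)) a h
    rw [pow_succ]
    calc Fintype.card (Block (q + q)) ^ (r + r) * Fintype.card (Block (q + q))
        ≤ ((r * (q + q) + 1) * (balancedWords (r + r) (q + q)).card) * 2 ^ (q + q) :=
          Nat.mul_le_mul (card_pow_le_balancedWords_even r _) hA
      _ ≤ (((r + r + 1) * (q + q) + 1) * (balancedWords (r + r + 1) (q + q)).card) *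
            2 ^ (q + q) := by
          gcongr
          omega
      _ = _ := by ring

/-- Concentration on balanced words, for the Hamming distance of the colorings. -/
lemma expConc_balancedWords (m k : ℕ) (hk : 2 ≤ k) (hmk : Even (m * k)) :
    ExpConc (balancedWords m k)
      (fun w w' => (hammingDist (fun x : Fin m × Fin k => (w.1 x.1).1 x.2)
        (fun x => (w'.1 x.1).1 x.2) : ℝ))
      ((2 ^ k * (m * k + 1)) ^ 2) (m * k ^ 2) := by
  have h1 : ExpConc (Block k) (fun a b => (hammingDist a.1 b.1 : ℝ)) 1 (k ^ 2 / 2) := by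
    refine ExpConc.of_bounded fun a b => ?_
    norm_cast
    simpa using hammingDist_le_card_fintype (x := a.1) (y := b.1)
  have h2 := h1.pi zero_le_one (by simp) m
  have h3 : ExpConc (Fin m → Block k)
      (fun w w' => (hammingDist (fun x : Fin m × Fin k => (w x.1).1 x.2)
        (fun x => (w' x.1).1 x.2) : ℝ)) (1 ^ m) (m * (k ^ 2 / 2)) := by
    refine h2.mono (fun w w' => le_of_eq ?_) le_rfl (by simp) le_rfl
    norm_cast
    simp only [hammingDist, card_filter]
    rw [← univ_product_univ, sum_product]
  -- Balance is imposed by conditioning the product of blocks, each of diameter at most `k`.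
  refine (h3.restrict (p := 2 ^ k * (m * k + 1)) (fun w : balancedWords m k => w.1)
    Subtype.val_injective (by simp) (fun x y => by rw [hammingDist_comm])
    (fun x y z => by exact_mod_cast hammingDist_triangle _ _ _) ?_).mono
    (fun _ _ => le_rfl) (by simp) (by positivity) (le_of_eq (by ring))
  rw [Fintype.card_coe]
  have := card_pow_le_balancedWords m k hk hmk
  rw [Fintype.card_fun, Fintype.card_fin]
  exact_mod_cast this

/-! ### The block shift and permutations with only `k`-cycles. -/

/-- Simultaneous cyclic shift of `m` blocks of size `k`. -/
def shift (m k : ℕ) [NeZero k] : Perm (Fin m × Fin k) :=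
  (Equiv.refl _).prodCongr (Equiv.addRight 1)

lemma shift_pow_apply {m k : ℕ} [NeZero k] (j : ℕ) (x : Fin m × Fin k) :
    (shift m k ^ j) x = (x.1, x.2 + j • (1 : Fin k)) := by
  induction j with
  | zero => simp
  | succ j ih =>
    rw [pow_succ', Perm.mul_apply, ih, succ_nsmul, ← add_assoc]
    rfl

lemma val_nsmul_one {k : ℕ} [NeZero k] (j : ℕ) : ((j • (1 : Fin k) : Fin k) : ℕ) = j % k := by
  induction j with
  | zero => simp
  | succ j ih =>
    rw [succ_nsmul, Fin.val_add, ih, Fin.val_one', ← Nat.add_mod]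

lemma shift_pow_self (m k : ℕ) [NeZero k] : shift m k ^ k = 1 := by
  ext1 x
  have h : k • (1 : Fin k) = 0 := Fin.ext (by rw [val_nsmul_one]; simp)
  rw [shift_pow_apply, h, add_zero]
  rfl

lemma shift_pow_apply_ne {m k : ℕ} [NeZero k] {j : ℕ} (hj : 0 < j) (hjk : j < k)
    (x : Fin m × Fin k) : (shift m k ^ j) x ≠ x := by
  rw [shift_pow_apply]
  intro h
  have h1 : x.2 + j • (1 : Fin k) = x.2 := congrArg Prod.snd h
  have h2 := congrArg Fin.val (add_eq_left.1 h1)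
  rw [val_nsmul_one, Nat.mod_eq_of_lt hjk] at h2
  simp at h2
  omega

lemma exists_shift_pow {m k : ℕ} [NeZero k] (x : Fin m × Fin k) (b : Fin k) :
    ∃ j < k, (shift m k ^ j) x = (x.1, b) := by
  refine ⟨(b - x.2 : Fin k), Fin.is_lt _, ?_⟩
  have : ((b - x.2 : Fin k) : ℕ) • (1 : Fin k) = b - x.2 := Fin.ext (by
    rw [val_nsmul_one, Nat.mod_eq_of_lt (Fin.is_lt _)])
  rw [shift_pow_apply, this, add_sub_cancel]

/-- A permutation acting freely with exponent `k` has only `k`-cycles. -/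
lemma cycleType_of_free {α : Type*} [Fintype α] [DecidableEq α] {k : ℕ} (hk : 2 ≤ k) (g : Perm α)
    (hg : g ^ k = 1) (hfree : ∀ v j, 0 < j → j < k → (g ^ j) v ≠ v) :
    g.cycleType = Multiset.replicate (Fintype.card α / k) k := by
  have h1 : ∀ p ∈ g.cycleType, p = k := by
    intro p hp
    have hpk : p ∣ k := (Perm.dvd_of_mem_cycleType hp).trans (orderOf_dvd_of_pow_eq_one hg)
    have hp2 := Perm.two_le_of_mem_cycleType hp
    by_contra hne
    have hlt : p < k := lt_of_le_of_ne (Nat.le_of_dvd (by omega) hpk) hne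
    obtain ⟨c, τ, rfl, hdisj, hc, rfl⟩ := Perm.mem_cycleType_iff.1 hp
    obtain ⟨v, hv⟩ : c.support.Nonempty := card_pos.1 (by omega)
    -- A point on a cycle of length `p < k` is fixed by the `p`-th power, against freeness.
    refine hfree v _ (by omega) hlt ?_
    have hτ : τ v = v := (hdisj v).resolve_left (Perm.mem_support.1 hv)
    rw [hdisj.commute.mul_pow, ← hc.orderOf, pow_orderOf_eq_one, one_mul]
    exact Perm.pow_apply_eq_self_of_apply_eq_self hτ _
  have h2 := Multiset.eq_replicate_card.2 h1
  have h3 : g.support = univ := by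
    ext v
    simpa using by simpa using hfree v 1 one_pos (by omega)
  have h4 := g.sum_cycleType
  rw [h3, card_univ, h2, Multiset.sum_replicate, smul_eq_mul] at h4
  rw [h2, ← h4, Nat.mul_div_cancel _ (by omega)]

lemma permCongr_pow {α β : Type*} (e : α ≃ β) (s : Perm α) (j : ℕ) :
    e.permCongr s ^ j = e.permCongr (s ^ j) :=
  (map_pow (Equiv.permCongrHom e) s j).symm

/-! ### Arrangements and the images of one generator. -/

/-- The possible images of a generator in the planted model. -/
abbrev GoodPerm (k : ℕ) {n : ℕ} (χ : Fin n → Fin 2) : Type :=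
  {g : Perm (Fin n) // g ^ k = 1 ∧ (∀ v j, 0 < j → j < k → (g ^ j) v ≠ v) ∧
    ∀ v, ∃ i < k, ∃ j < k, χ ((g ^ i) v) ≠ χ ((g ^ j) v)}

/-- Arrangements of `Fin n` into blocks which are not monochromatic. -/
abbrev Arrangement (m k : ℕ) {n : ℕ} (χ : Fin n → Fin 2) : Type :=
  {π : Fin m × Fin k ≃ Fin n // ∀ a, ∃ b b', χ (π (a, b)) ≠ χ (π (a, b'))}

lemma card_color_one {n : ℕ} {χ : Fin n → Fin 2} (hχ : IsEquitable χ) :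
    2 * ∑ v, (χ v : ℕ) = n := by
  have h1 : ∑ v, (χ v : ℕ) = (univ.filter fun v => χ v = 1).card := by
    rw [card_filter]
    refine sum_congr rfl fun v _ => ?_
    generalize χ v = a
    revert a
    decide
  have h2 := card_filter_add_card_filter_not (s := (univ : Finset (Fin n))) (fun v => χ v = 1)
  have h3 : (univ.filter fun v => ¬ χ v = 1) = univ.filter fun v => χ v = 0 := by
    ext v
    simp only [mem_filter, mem_univ, true_and]
    generalize χ v = a
    revert a
    decide
  rw [h3, hχ, card_univ, Fintype.card_fin] at h2
  rw [h1]
  omega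

/-- Equitability of `χ` and balance of `w` give the two colorings equal class sizes, so any
bijection can be corrected by a permutation of its source. -/
lemma exists_equiv_of_balanced {n m k : ℕ} (hn : n = m * k) {χ : Fin n → Fin 2}
    (hχ : IsEquitable χ) (w : balancedWords m k) :
    ∃ π : Fin m × Fin k ≃ Fin n, ∀ x, χ (π x) = (w.1 x.1).1 x.2 := by
  let e : Fin m × Fin k ≃ Fin n := Fintype.equivOfCardEq (by simp [hn])
  have h1 : ∀ f : Fin m × Fin k → Fin 2,
      ∑ x, (f x : ℕ) = (univ.filter fun x => f x = 1).card := by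
    intro f
    rw [card_filter]
    refine sum_congr rfl fun v _ => ?_
    generalize f v = a
    revert a
    decide
  have h0 : ∀ f : Fin m × Fin k → Fin 2, (univ.filter fun x => f x = 0).card +
      (univ.filter fun x => f x = 1).card = m * k := by
    intro f
    have h2 := card_filter_add_card_filter_not (s := (univ : Finset (Fin m × Fin k)))
      (fun v => f v = 0)
    have h3 : (univ.filter fun v => ¬ f v = 0) = univ.filter fun v => f v = 1 := by
      ext v
      simp only [mem_filter, mem_univ, true_and]
      generalize f v = a
      revert a
      decide
    rw [h3] at h2
    simpa using h2
  set f : Fin m × Fin k → Fin 2 := fun x => χ (e x) with hf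
  set g : Fin m × Fin k → Fin 2 := fun x => (w.1 x.1).1 x.2 with hg
  have hf2 : 2 * ∑ x, (f x : ℕ) = m * k := by
    rw [← hn, ← card_color_one hχ, hf, e.sum_comp (fun v => (χ v : ℕ))]
  have hg2 : 2 * ∑ x, (g x : ℕ) = m * k := by
    rw [← (mem_filter.1 w.2).2, ← univ_product_univ, sum_product]
    rfl
  have hcard : ∀ c, (univ.filter fun x => f x = c).card = (univ.filter fun x => g x = c).card := by
    have e1 := h0 f
    have e2 := h0 g
    rw [h1] at hf2 hg2
    intro c
    fin_cases c
    · change (univ.filter fun x => f x = 0).card = (univ.filter fun x => g x = 0).card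
      omega
    · change (univ.filter fun x => f x = 1).card = (univ.filter fun x => g x = 1).card
      omega
  obtain ⟨τ, hτ, -⟩ := exists_perm_of_card_fiber f g hcard
  exact ⟨τ.trans e, hτ⟩

/-- Concentration on arrangements. -/
lemma expConc_arrangement {n m k : ℕ} (hk : 2 ≤ k) (hn : n = m * k) (hn2 : Even n)
    {χ : Fin n → Fin 2} (hχ : IsEquitable χ) :
    ExpConc (Arrangement m k χ) (fun π π' => (hammingDist ⇑π.1 ⇑π'.1 : ℝ))
      ((2 ^ k * (n + 1)) ^ 2) ((k + 5) * n) := by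
  -- A reference arrangement for each word; every arrangement is uniquely one of these followed by a
  -- permutation preserving `χ`.
  choose p hp using exists_equiv_of_balanced (m := m) (k := k) hn hχ
  have hmem : ∀ x : balancedWords m k × {h : Perm (Fin n) // ∀ v, χ (h v) = χ v},
      ∀ a, ∃ b b', χ (((p x.1).trans x.2.1) (a, b)) ≠ χ (((p x.1).trans x.2.1) (a, b')) := by
    intro x a
    obtain ⟨b, b', h⟩ := (x.1.1 a).2
    refine ⟨b, b', ?_⟩
    simpa only [trans_apply, x.2.2, hp] using h
  let ψ : balancedWords m k × {h : Perm (Fin n) // ∀ v, χ (h v) = χ v} → Arrangement m k χ :=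
    fun x => ⟨(p x.1).trans x.2.1, hmem x⟩
  have h1 := expConc_balancedWords m k hk (hn ▸ hn2)
  have h2 : ExpConc (balancedWords m k × {h : Perm (Fin n) // ∀ v, χ (h v) = χ v})
      (fun x y => (hammingDist ⇑(ψ x).1 ⇑(ψ y).1 : ℝ)) ((2 ^ k * (m * k + 1)) ^ 2 * 1)
      (m * k ^ 2 + 5 * Fintype.card (Fin n)) := by
    refine h1.prod (expConc_preserving χ) zero_le_one (fun w h h' => ?_) fun w w' => ?_
    · norm_cast
      exact (card_equiv (p w) fun x => by rw [mem_filter, mem_filter]; simp [ψ]).le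
    · obtain ⟨τ, hτ, hτ'⟩ := exists_perm_of_card_fiber
        (fun x : Fin m × Fin k => (w.1 x.1).1 x.2) (fun x => (w'.1 x.1).1 x.2) fun c => by
          rw [card_equiv (t := univ.filter fun v => χ v = c) (p w) fun x => by simp [hp],
            card_equiv (t := univ.filter fun v => χ v = c) (p w') fun x => by simp [hp]]
      -- The coupling `h ↦ h ∘ r` is chosen so that `h ∘ r ∘ p w' = h ∘ p w ∘ τ`. As `τ` fixes the
      -- positions where the words agree, the arrangements differ only where the words do.
      set r : Perm (Fin n) := (p w').symm.trans (τ.trans (p w)) with hr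
      have hrχ : ∀ v, χ (r v) = χ v := by
        intro v
        rw [hr, trans_apply, trans_apply, hp, hτ, ← hp, apply_symm_apply]
      have hrχ' : ∀ v, χ (r.symm v) = χ v := by
        intro v
        rw [← hrχ, apply_symm_apply]
      refine ⟨⟨fun h => ⟨r.trans h.1, fun v => by rw [trans_apply, h.2, hrχ]⟩,
        fun h => ⟨r.symm.trans h.1, fun v => by rw [trans_apply, h.2, hrχ']⟩,
        fun h => by ext; simp, fun h => by ext; simp⟩, fun h => ?_⟩
      norm_cast
      refine card_le_card fun x hx => ?_
      rw [mem_filter] at hx ⊢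
      refine ⟨mem_univ _, fun hw => hx.2 ?_⟩
      have := hτ' x hw
      simp [ψ, hr, this]
  have h3 := h2.map_bijective (DX := fun π π' : Arrangement m k χ =>
    (hammingDist ⇑π.1 ⇑π'.1 : ℝ)) ψ ⟨?_, ?_⟩ fun _ _ => le_rfl
  · refine h3.mono (fun _ _ => le_rfl) (le_of_eq ?_) (by positivity) (le_of_eq ?_)
    · rw [hn]
      push_cast
      ring
    · rw [Fintype.card_fin, hn]
      push_cast
      ring
  · rintro ⟨w, h⟩ ⟨w', h'⟩ hxy
    have h4 : ∀ x, h.1 (p w x) = h'.1 (p w' x) := fun x =>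
      Equiv.congr_fun (Subtype.ext_iff.1 hxy) x
    have h5 : w = w' := by
      ext i b
      have := congrArg χ (h4 (i, b))
      rw [h.2, h'.2, hp, hp] at this
      rw [this]
    subst h5
    refine Prod.ext rfl (Subtype.ext (Equiv.ext fun v => ?_))
    have := h4 ((p w).symm v)
    simpa using this
  · rintro ⟨π, hπ⟩
    have hbal : (fun a => (⟨fun b => χ (π (a, b)), hπ a⟩ : Block k)) ∈ balancedWords m k := by
      rw [mem_filter]
      refine ⟨mem_univ _, ?_⟩
      rw [← hn]
      conv_rhs => rw [← card_color_one hχ]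
      rw [← π.sum_comp (fun v => (χ v : ℕ)), ← univ_product_univ, sum_product]
      rfl
    refine ⟨(⟨_, hbal⟩, ⟨(p ⟨_, hbal⟩).symm.trans π, fun v => ?_⟩), ?_⟩
    · have := hp ⟨_, hbal⟩ ((p ⟨_, hbal⟩).symm v)
      rw [apply_symm_apply] at this
      rw [this]
      rfl
    · ext x
      simp [ψ]

/-- The fibre through `π` consists of the `π ∘ z` with `z` in the centralizer of `s`, so its size
does not depend on `π`. -/
lemma card_conj_fiber {α β : Type*} [Fintype α] [Fintype β] [DecidableEq α] [DecidableEq β]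
    (s : Perm α) (π : α ≃ β) :
    (univ.filter fun π' : α ≃ β => π'.permCongr s = π.permCongr s).card =
      (univ.filter fun z : Perm α => z * s = s * z).card := by
  symm
  refine card_bij (fun z _ => z.trans π) ?_ ?_ ?_
  · intro z hz
    rw [mem_filter] at hz ⊢
    refine ⟨mem_univ _, Equiv.ext fun v => ?_⟩
    have h := Equiv.congr_fun hz.2 (z.symm (π.symm v))
    simp only [Perm.mul_apply, apply_symm_apply] at h
    simp [permCongr_apply, h]
  · intro z _ z' _ h
    ext x
    simpa using Equiv.congr_fun h x
  · intro π' h'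
    rw [mem_filter] at h'
    refine ⟨π'.trans π.symm, ?_, ?_⟩
    · rw [mem_filter]
      refine ⟨mem_univ _, Equiv.ext fun x => ?_⟩
      have h := Equiv.congr_fun h'.2 (π' x)
      simp only [permCongr_apply, symm_apply_apply] at h
      simp [h]
    · ext x
      simp

/-- Concentration on the possible images of a generator. -/
lemma expConc_goodPerm {n k : ℕ} (hk : 2 ≤ k) (hkn : k ∣ n) (hn2 : Even n)
    {χ : Fin n → Fin 2} (hχ : IsEquitable χ) [Fintype (GoodPerm k χ)] :
    ExpConc (GoodPerm k χ) (fun g h => (hammingDist ⇑g.1 ⇑h.1 : ℝ))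
      ((2 ^ k * (n + 1)) ^ 2) (4 * ((k + 5) * n)) := by
  classical
  obtain ⟨m, hm⟩ := hkn
  rw [mul_comm] at hm
  have : NeZero k := ⟨by omega⟩
  have hgood : ∀ π : Arrangement m k χ, (π.1.permCongr (shift m k)) ^ k = 1 ∧
      (∀ v j, 0 < j → j < k → ((π.1.permCongr (shift m k)) ^ j) v ≠ v) ∧
      ∀ v, ∃ i < k, ∃ j < k, χ (((π.1.permCongr (shift m k)) ^ i) v) ≠
        χ (((π.1.permCongr (shift m k)) ^ j) v) := by
    intro π
    refine ⟨?_, fun v j hj hjk h => ?_, fun v => ?_⟩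
    · rw [permCongr_pow, shift_pow_self]
      ext
      simp
    · rw [permCongr_pow, permCongr_apply] at h
      refine shift_pow_apply_ne hj hjk (π.1.symm v) ?_
      rw [← π.1.symm_apply_apply ((shift m k ^ j) (π.1.symm v)), h]
    · obtain ⟨b, b', h⟩ := π.2 (π.1.symm v).1
      obtain ⟨i, hi, hi'⟩ := exists_shift_pow (π.1.symm v) b
      obtain ⟨j, hj, hj'⟩ := exists_shift_pow (π.1.symm v) b'
      refine ⟨i, hi, j, hj, ?_⟩
      rw [permCongr_pow, permCongr_pow, permCongr_apply, permCongr_apply, hi', hj']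
      exact h
  -- The arrangement condition is automatic on the fibre over a good permutation, so
  -- `card_conj_fiber` counts fibres within arrangements as well.
  have hpull : ∀ (g : GoodPerm k χ) (π : Fin m × Fin k ≃ Fin n),
      π.permCongr (shift m k) = g.1 → ∀ a, ∃ b b', χ (π (a, b)) ≠ χ (π (a, b')) := by
    intro g π h a
    obtain ⟨i, -, j, -, hij⟩ := g.2.2.2 (π (a, 0))
    rw [← h, permCongr_pow, permCongr_pow, permCongr_apply, permCongr_apply, symm_apply_apply,
      shift_pow_apply, shift_pow_apply] at hij
    exact ⟨_, _, hij⟩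
  have hex : ∀ g : GoodPerm k χ, ∃ π : Fin m × Fin k ≃ Fin n,
      π.permCongr (shift m k) = g.1 := by
    intro g
    let e : Fin m × Fin k ≃ Fin n := Fintype.equivOfCardEq (by simp [hm])
    have h1 := cycleType_of_free hk g.1 g.2.1 g.2.2.1
    have h2 := cycleType_of_free hk (e.permCongr (shift m k))
      (by rw [permCongr_pow, shift_pow_self]; ext; simp) (fun v j hj hjk h => by
        rw [permCongr_pow, permCongr_apply] at h
        refine shift_pow_apply_ne hj hjk (e.symm v) ?_
        rw [← e.symm_apply_apply ((shift m k ^ j) (e.symm v)), h])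
    -- Both permutations consist of `n / k` cycles of length `k`, and cycle type determines the
    -- conjugacy class.
    obtain ⟨c, hc⟩ := isConj_iff.1 (Perm.isConj_iff_cycleType_eq.2 (h2.trans h1.symm))
    refine ⟨e.trans c, ?_⟩
    rw [← hc]
    ext v
    simp [permCongr_apply]
  -- The value at `v` of the conjugate by `π` involves `π` at two positions only, `π.symm v` and its
  -- shift; hence the Lipschitz factor `2`, and `4` in the variance.
  have h0 := (expConc_arrangement hk hm hn2 hχ).scale (c := 2) zero_le_two
  have h1 := h0.map (DX := fun g h : GoodPerm k χ => (hammingDist ⇑g.1 ⇑h.1 : ℝ))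
    (fun π : Arrangement m k χ => (⟨π.1.permCongr (shift m k), hgood π⟩ : GoodPerm k χ))
    (N := (univ.filter fun z : Perm (Fin m × Fin k) => z * shift m k = shift m k * z).card)
    ?_ ?_ ?_
  · exact h1.mono (fun _ _ => le_rfl) le_rfl (by positivity) (le_of_eq (by ring))
  · exact card_ne_zero_of_mem (a := 1) (by simp)
  · intro g
    obtain ⟨π, hπ⟩ := hex g
    rw [← card_conj_fiber (shift m k) π, ← card_map (Function.Embedding.subtype _)]
    congr 1
    ext π'
    simp only [mem_map, mem_filter, mem_univ, true_and, Function.Embedding.subtype_apply]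
    constructor
    · rintro ⟨a, ha, rfl⟩
      rw [hπ, ← ha]
    · intro h
      exact ⟨⟨π', hpull g π' (h.trans hπ)⟩, Subtype.ext (h.trans hπ), rfl⟩
  · rintro ⟨π, _⟩ ⟨π', _⟩
    norm_cast
    calc hammingDist ⇑(π.permCongr (shift m k)) ⇑(π'.permCongr (shift m k))
        ≤ ((univ.filter fun x => π x ≠ π' x).map π.toEmbedding ∪
            ((univ.filter fun x => π x ≠ π' x).map (shift m k).symm.toEmbedding).map
              π.toEmbedding).card := by
          refine card_le_card fun v hv => ?_
          rw [mem_filter] at hv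
          by_contra hcon
          simp only [mem_union, mem_map_equiv, mem_filter, mem_univ, true_and, not_or, not_not,
            symm_symm, apply_symm_apply] at hcon
          refine hv.2 ?_
          have h4 : π'.symm v = π.symm v := by
            rw [symm_apply_eq]
            exact hcon.1
          rw [permCongr_apply, permCongr_apply, h4]
          exact hcon.2
      _ ≤ _ := (card_union_le _ _).trans_eq (by rw [card_map, card_map, card_map, two_mul]; rfl)

/-! ### From one generator to the planted model. -/

lemma gen_pow (k d : ℕ) (i : Fin d) : gen k d i ^ k = 1 :=
  PresentedGroup.one_of_mem (x := FreeGroup.of i ^ k) ⟨i, rfl⟩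

/-- For `k = 1` the edges are singletons, hence monochromatic. This supplies the condition `2 ≤ k`
of the concentration lemmas. -/
lemma two_le_of_nonempty_homChi {k d n : ℕ} (hk : 0 < k) (hd : 0 < d) (hn : 0 < n)
    {χ : Fin n → Fin 2} (h : Nonempty (HomChi k d χ)) : 2 ≤ k := by
  obtain ⟨σ, -, hσ⟩ := h
  by_contra hlt
  obtain rfl : k = 1 := by omega
  obtain ⟨v, hv, w, hw, hvw⟩ := hσ _ ⟨⟨0, hd⟩, ⟨0, hn⟩, rfl⟩
  simp only [range_one, image_singleton, mem_singleton] at hv hw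
  exact hvw (by rw [hv, hw])

/-- The homomorphism with prescribed images of the generators. -/
def homOfGood {k d n : ℕ} {χ : Fin n → Fin 2} (g : Fin d → GoodPerm k χ) : HomSym k d n :=
  PresentedGroup.toGroup (f := fun i => (g i).1) (by
    rintro _ ⟨i, rfl⟩
    rw [map_pow, FreeGroup.lift_apply_of]
    exact (g i).2.1)

lemma homOfGood_gen {k d n : ℕ} {χ : Fin n → Fin 2} (g : Fin d → GoodPerm k χ) (i : Fin d) :
    homOfGood g (gen k d i) = (g i).1 :=
  PresentedGroup.toGroup.of _

lemma homOfGood_mem {k d n : ℕ} {χ : Fin n → Fin 2} (g : Fin d → GoodPerm k χ) :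
    IsUniformHom (homOfGood g) ∧ IsProper (homOfGood g) χ := by
  constructor
  · rintro e ⟨i, v, rfl⟩
    have key : ∀ a b : ℕ, a < b → b < k → ((g i).1 ^ a) v ≠ ((g i).1 ^ b) v := by
      intro a b hab hb h
      refine (g i).2.2.1 v (b - a) (by omega) (by omega) ?_
      apply ((g i).1 ^ a).injective
      rw [← Perm.mul_apply, ← pow_add, Nat.add_sub_cancel' hab.le, h]
    rw [card_image_of_injOn, card_range]
    intro a ha b hb hab
    simp only [map_pow, homOfGood_gen] at hab
    rw [mem_coe, mem_range] at ha hb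
    rcases lt_trichotomy a b with h | h | h
    · exact absurd hab (key a b h hb)
    · exact h
    · exact absurd hab.symm (key b a h ha)
  · rintro e ⟨i, v, rfl⟩
    obtain ⟨a, ha, b, hb, hab⟩ := (g i).2.2.2 v
    refine ⟨_, mem_image_of_mem _ (mem_range.2 ha), _, mem_image_of_mem _ (mem_range.2 hb), ?_⟩
    simpa only [map_pow, homOfGood_gen] using hab

/-- The defining conditions on `GoodPerm` are the relation, uniformity and properness, each read off
at one generator, so the generators may be chosen independently. -/
lemma homOfGood_bijective {k d n : ℕ} (hk : 2 ≤ k) {χ : Fin n → Fin 2} :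
    Function.Bijective fun g : Fin d → GoodPerm k χ =>
      (⟨homOfGood g, homOfGood_mem g⟩ : HomChi k d χ) := by
  constructor
  · intro g g' h
    funext i
    apply Subtype.ext
    have h1 : homOfGood g = homOfGood g' := Subtype.ext_iff.1 h
    rw [← homOfGood_gen g, ← homOfGood_gen g', h1]
  · rintro ⟨σ, hσ, hσ'⟩
    refine ⟨fun i => ⟨σ (gen k d i), ?_, ?_, ?_⟩, ?_⟩
    · rw [← map_pow, gen_pow, map_one]
    · intro v j hj hjk h
      have h1 := hσ _ ⟨i, v, rfl⟩
      have h2 := card_image_iff.1 (h1.trans (card_range k).symm)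
      have h3 := h2 (by simpa using hjk : j ∈ (range k : Set ℕ))
        (by simpa using by omega : 0 ∈ (range k : Set ℕ)) (by simpa using h)
      omega
    · intro v
      obtain ⟨x, hx, y, hy, hxy⟩ := hσ' _ ⟨i, v, rfl⟩
      obtain ⟨a, ha, rfl⟩ := mem_image.1 hx
      obtain ⟨b, hb, rfl⟩ := mem_image.1 hy
      refine ⟨a, mem_range.1 ha, b, mem_range.1 hb, ?_⟩
      simpa only [map_pow] using hxy
    · apply Subtype.ext
      exact PresentedGroup.ext fun i => homOfGood_gen _ i

/-- Concentration in the planted model. -/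
lemma expConc_homChi {k d n : ℕ} (hk : 2 ≤ k) (hkn : k ∣ n) (hn2 : Even n) (hn : 0 < n)
    {χ : Fin n → Fin 2} (hχ : IsEquitable χ) [Fintype (HomChi k d χ)] :
    ExpConc (HomChi k d χ) (fun σ τ => dHom σ.1 τ.1)
      (((2 ^ k * (n + 1)) ^ 2) ^ d) (4 * d * (k + 5) / n) := by
  classical
  -- Normalizing by `1 / n` turns a variance linear in `n` into one of order `1 / n`.
  have h1 := ((expConc_goodPerm hk hkn hn2 hχ).pi (by positivity) (by simp) d).scale
    (c := (n : ℝ)⁻¹) (by positivity)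
  have h2 := h1.map_bijective (DX := fun σ τ : HomChi k d χ => dHom σ.1 τ.1) _
    (homOfGood_bijective hk) fun g g' => by
      simp only [dHom, dSym, homOfGood_gen]
      rw [← sum_div, div_eq_inv_mul]
      rfl
  refine h2.mono (fun _ _ => le_rfl) le_rfl (by positivity) (le_of_eq ?_)
  have : (n : ℝ) ≠ 0 := by positivity
  field_simp

lemma planted_real {k d n : ℕ} {χ : Fin n → Fin 2} [Fintype (HomChi k d χ)]
    (P : HomChi k d χ → Prop) [DecidablePred P] :
    (planted k d χ).real {σ | P σ} =
      ((univ.filter P).card : ℝ) / Fintype.card (HomChi k d χ) := by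
  have : MeasurableSingletonClass (HomChi k d χ) := ⟨fun _ => trivial⟩
  have h : {σ | P σ} = ((univ.filter P : Finset (HomChi k d χ)) : Set (HomChi k d χ)) := by
    ext
    simp
  rw [Measure.real, planted, uniformOn_univ, h, Measure.count_apply_finset, ENNReal.toReal_div]
  simp

lemma integral_planted {k d n : ℕ} {χ : Fin n → Fin 2} [Fintype (HomChi k d χ)]
    [Nonempty (HomChi k d χ)] (f : HomChi k d χ → ℝ) :
    ∫ τ, f τ ∂(planted k d χ) = 𝔼 τ, f τ := by
  classical
  have : MeasurableSingletonClass (HomChi k d χ) := ⟨fun _ => trivial⟩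
  have : IsProbabilityMeasure (planted k d χ) := by
    rw [planted]
    infer_instance
  rw [integral_fintype .of_finite, Fintype.expect_eq_sum_div_card, sum_div]
  refine sum_congr rfl fun σ _ => ?_
  have h := planted_real (fun τ : HomChi k d χ => τ = σ)
  rw [Set.ofPred_eq_eq_singleton, filter_eq' univ σ, if_pos (mem_univ _), card_singleton] at h
  rw [h, smul_eq_mul, Nat.cast_one, one_div_mul_eq_div]

/-- Absorbs the prefactor due to conditioning, a polynomial in `n` of degree `2 * d`. With `a = lam
* δ ^ 2` it provides the threshold depending on `δ`. -/
lemma exists_poly_le_exp (k d : ℕ) {a : ℝ} (ha : 0 < a) :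
    ∃ N : ℕ, ∀ n : ℕ, N < n →
      2 * ((2 ^ k * ((n : ℝ) + 1)) ^ 2) ^ d ≤ Real.exp (a * n) := by
  set C : ℝ := 2 * ((2 ^ k * 2) ^ 2) ^ d with hC
  have hC0 : 0 < C := by positivity
  have h1 := (isLittleO_pow_exp_pos_mul_atTop (k := 2 * d) ha).comp_tendsto
    tendsto_natCast_atTop_atTop
  have h2 := h1.bound (c := C⁻¹) (by positivity)
  obtain ⟨N, hN⟩ := Filter.eventually_atTop.1 h2
  refine ⟨N, fun n hn => ?_⟩
  have h3 := hN n hn.le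
  simp only [Function.comp_apply, Real.norm_eq_abs, Real.abs_exp] at h3
  rw [abs_of_nonneg (by positivity), inv_mul_eq_div, le_div_iff₀ hC0] at h3
  refine le_trans ?_ h3
  have h4 : (1 : ℝ) ≤ n := by exact_mod_cast (by omega : 1 ≤ n)
  calc 2 * ((2 ^ k * ((n : ℝ) + 1)) ^ 2) ^ d ≤ 2 * ((2 ^ k * (2 * (n : ℝ))) ^ 2) ^ d := by
        gcongr
        linarith
    _ = (n : ℝ) ^ (2 * d) * C := by
        rw [hC, pow_mul, ← mul_assoc, mul_pow _ (n : ℝ), mul_pow _ ((n : ℝ) ^ 2)]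
        ring

end PlantedConcentration

theorem theoremB1 (k d : ℕ) (hk : 0 < k) (hd : 0 < d) :
    ∃ c : ℝ, 0 < c ∧ ∃ lam : ℝ, 0 < lam ∧
      ∀ δ : ℝ, 0 < δ →
        ∃ N : ℕ, ∀ n : ℕ, N < n → Even n → k ∣ n →
          ∀ χ : Fin n → Fin 2, PlantedConcentration.IsEquitable χ →
            ∀ f : PlantedConcentration.HomChi k d χ → ℝ,
              (∀ σ τ : PlantedConcentration.HomChi k d χ,
                |f σ - f τ| ≤ PlantedConcentration.dHom σ.1 τ.1) →
              (PlantedConcentration.planted k d χ).real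
                  {σ | δ < |f σ - ∫ τ, f τ ∂(PlantedConcentration.planted k d χ)|}
                ≤ c * Real.exp (-lam * δ ^ 2 * n) := by
  classical
  -- Half the rate `1 / (16 * d * (k + 5))` given by `ExpConc.tail`; the other half cancels the
  -- prefactor, which allows `c = 1`.
  set lam : ℝ := 1 / (32 * d * (k + 5)) with hlam
  have hlam0 : 0 < lam := by positivity
  refine ⟨1, one_pos, lam, hlam0, fun δ hδ => ?_⟩
  obtain ⟨N, hN⟩ := PlantedConcentration.exists_poly_le_exp k d (a := lam * δ ^ 2) (by positivity)
  refine ⟨N, fun n hn hn2 hkn χ hχ f hf => ?_⟩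
  have hn0 : 0 < n := by omega
  rcases isEmpty_or_nonempty (PlantedConcentration.HomChi k d χ) with hE | hE
  · rw [Set.eq_empty_of_isEmpty {σ | _}, measureReal_empty]
    positivity
  have hk2 := PlantedConcentration.two_le_of_nonempty_homChi hk hd hn0 hE
  have := Fintype.ofFinite (PlantedConcentration.HomChi k d χ)
  rw [PlantedConcentration.planted_real, PlantedConcentration.integral_planted]
  refine ((PlantedConcentration.expConc_homChi hk2 hkn hn2 hn0 hχ).tail
    (by positivity) hδ f hf).trans ?_
  have e : δ ^ 2 / (4 * (4 * d * (k + 5) / n)) = lam * δ ^ 2 * n + lam * δ ^ 2 * n := by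
    rw [hlam]
    field_simp
    norm_num
  rw [e, neg_add, Real.exp_add, ← mul_assoc, neg_mul, neg_mul]
  refine mul_le_mul_of_nonneg_right ?_ (Real.exp_pos _).le
  rw [Real.exp_neg, ← div_eq_mul_inv, div_le_one (Real.exp_pos _)]
  exact hN n hn
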